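/- Let $R$ be a commutative artinian ring and let $A$ be an Artin $R$-algebra, that is, an $R$-algebra which is finitely generated as an $R$-module. Let $\mathrm{mod}_A$ be the category of finitely generated right $A$-modules. For indecomposable modules $X,Y\in\mathrm{mod}_A$, call $X$ a predecessor of $Y$ if there is a path $X=X_0\to X_1\to\cdots\to X_t=Y$ of nonzero morphisms between indecomposable modules in $\mathrm{mod}_A$. The left part $\mathcal{L}_A$ is the full subcategory of indecomposable modules all of whose predecessors have projective dimension at most one, and $\mathrm{add}(\mathcal{L}_A)$ is the full subcategory of $\mathrm{mod}_A$ of direct summands of finite direct sums of modules in $\mathcal{L}_A$. The left support of $A$ is the $R$-algebra $A_\lambda=\mathrm{End}_A(P)$, where $P$ is the direct sum of all indecomposable projective modules in $\mathcal{L}_A$, one from each isomorphism class. The algebra $A$ is left supported if $\mathrm{add}(\mathcal{L}_A)$ is contravariantly finite in $\mathrm{mod}_A$, i.e. if for every $X\in\mathrm{mod}_A$ there is a morphism $f\colon D_X\to X$ with $D_X\in\mathrm{add}(\mathcal{L}_A)$ through which every morphism $D\to X$ with $D\in\mathrm{add}(\mathcal{L}_A)$ factors. A ring is called hereditary here if all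 its right ideals are projective (for Artin algebras this is equivalent to the condition on left ideals). The points of the (valued) quiver of $A$ are the primitive idempotents $e$ of $A$ up to isomorphism of the right modules $eA$, with an arrow from $e$ to $f$ when $eJf/eJ^2f\neq 0$, where $J$ is the Jacobson radical of $A$. Assume that $\mathrm{add}(\mathcal{L}_A)$ is an abelian exact subcategory of $\mathrm{mod}_A$, that is, it is abelian as a category and its inclusion into $\mathrm{mod}_A$ is an exact functor. Then: 1. The left support $A_\lambda$ is hereditary. 2. The algebra $A$ is left supported. 3. If, furthermore, the valued quiver of $A$ has no oriented cycles (loops included), then $A$ is hereditary; and if moreover $A$ is basic (i.e. $1$ is a sum of orthogonal primitive idempotents $e_1,\dots,e_n$ with the modules $e_iA$ pairwise nonisomorphic), then $A\cong A_\lambda$ as $R$-algebras. -/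

import Mathlib

open CategoryTheory Limits
open scoped DirectSum

universe u v

namespace ArtinLeft

noncomputable section

/-- `mod_A`: the category of finitely generated right `A`-modules, a right `A`-module being a
module over `Aᵐᵒᵖ`. -/
abbrev RMod (A : Type u) [Ring A] := FGModuleCat.{u} Aᵐᵒᵖ

section Subcategories

variable {A : Type u} [Ring A]

/-- The objects of `ind_A`. A subcategory of `ind_A` is represented by the class of all modules
isomorphic to one of its members. -/
def IsInd (X : RMod A) : Prop := Indecomposable X.obj

/-- One step of a path: a nonzero morphism between indecomposable modules. -/
def Step (X Y : RMod A) : Prop :=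
  IsInd X ∧ IsInd Y ∧ ∃ f : X →ₗ[Aᵐᵒᵖ] Y, f ≠ 0

/-- `X` is a predecessor of `Y`: there is a path `X = X₀ → X₁ → ⋯ → X_t = Y` of nonzero morphisms
between indecomposable modules. -/
def IsPredecessor (X Y : RMod A) : Prop := Relation.ReflTransGen Step X Y

variable (A) in
/-- The left part `ℒ_A` of `mod_A`: the indecomposable modules all of whose predecessors have
projective dimension at most one. -/
def leftPart : ObjectProperty (RMod A) := fun X =>
  IsInd X ∧ ∀ Y : RMod A, IsPredecessor Y X → HasProjectiveDimensionLE Y.obj 1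

/-- `add(𝒞)`: the direct summands of finite direct sums of modules in `𝒞`. -/
def addClosure (C : ObjectProperty (RMod A)) : ObjectProperty (RMod A) := fun X =>
  ∃ (n : ℕ) (F : Fin n → RMod A), (∀ i, C (F i)) ∧
    ∃ (i : X →ₗ[Aᵐᵒᵖ] (⨁ k, F k)) (p : (⨁ k, F k) →ₗ[Aᵐᵒᵖ] X), p ∘ₗ i = LinearMap.id

/-- The full subcategory of `mod_A` on `C` is abelian as a category, and its inclusion into
`mod_A` is an exact functor. -/
def IsAbelianExact (C : ObjectProperty (RMod A)) : Prop :=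
  Nonempty (Abelian C.FullSubcategory) ∧
    PreservesFiniteLimits C.ι ∧ PreservesFiniteColimits C.ι

/-- Every module has a right approximation by a module in `D`. -/
def IsContravariantlyFinite (D : ObjectProperty (RMod A)) : Prop :=
  ∀ X : RMod A, ∃ (DX : RMod A) (f : DX ⟶ X), D DX ∧
    ∀ (E : RMod A) (g : E ⟶ X), D E → ∃ h : E ⟶ DX, h ≫ f = g

/-- The indecomposable projective modules lying in `C`. -/
def IndProj (C : ObjectProperty (RMod A)) : Type (u + 1) :=
  {X : RMod A // IsInd X ∧ C X ∧ Module.Projective Aᵐᵒᵖ X}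

/-- Isomorphism of indecomposable projective modules in `C`. -/
instance indProjSetoid (C : ObjectProperty (RMod A)) : Setoid (IndProj C) where
  r X Y := Nonempty (X.1 ≃ₗ[Aᵐᵒᵖ] Y.1)
  iseqv := ⟨fun _ => ⟨LinearEquiv.refl _ _⟩, fun ⟨e⟩ => ⟨e.symm⟩, fun ⟨e⟩ ⟨f⟩ => ⟨e.trans f⟩⟩

/-- The supporting projective of `C`: the direct sum of all indecomposable projective modules in
`C`, one from each isomorphism class. -/
abbrev SupportingProjective (C : ObjectProperty (RMod A)) : Type (u + 1) :=
  ⨁ q : _root_.Quotient (indProjSetoid C), ((_root_.Quotient.out q).1 : RMod A)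

end Subcategories

/-- The left support `A_λ`: the endomorphism ring of the supporting projective of `ℒ_A`. -/
def LeftSupport (A : Type u) [Ring A] : Type (u + 1) :=
  Module.End Aᵐᵒᵖ (SupportingProjective (leftPart A))

instance (A : Type u) [Ring A] : Ring (LeftSupport A) :=
  inferInstanceAs (Ring (Module.End Aᵐᵒᵖ (SupportingProjective (leftPart A))))

/-- `r : R` acts on the supporting projective as right multiplication by the central element
`algebraMap R A r`. -/
def leftSupportScalar (R : Type v) [CommRing R] (A : Type u) [Ring A] [Algebra R A] :
    R →+* Module.End Aᵐᵒᵖ (SupportingProjective (leftPart A)) where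
  toFun r :=
    { toFun := fun x => MulOpposite.op (algebraMap R A r) • x
      map_add' := fun x y => smul_add _ x y
      map_smul' := fun a x => by
        rw [smul_smul, RingHom.id_apply, smul_smul]
        congr 1
        exact MulOpposite.unop_injective (Algebra.commutes r a.unop).symm }
  map_one' := by ext1 x; simp
  map_mul' r s := by
    ext1 x
    simp [smul_smul, ← MulOpposite.op_mul, ← map_mul]
  map_zero' := by ext1 x; simp
  map_add' r s := by ext1 x; simp [add_smul]

/-- The left support of an `R`-algebra is an `R`-algebra. -/
instance leftSupportAlgebra (R : Type v) [CommRing R] (A : Type u) [Ring A] [Algebra R A] :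
    Algebra R (LeftSupport A) :=
  RingHom.toAlgebra' (S := LeftSupport A) (leftSupportScalar R A) fun r f =>
    LinearMap.ext fun x =>
      (LinearMap.map_smul (show Module.End Aᵐᵒᵖ (SupportingProjective (leftPart A)) from f)
        (MulOpposite.op (algebraMap R A r)) x).symm

/-- `A` is left supported: `add(ℒ_A)` is contravariantly finite in `mod_A`. -/
def IsLeftSupported (A : Type u) [Ring A] : Prop :=
  IsContravariantlyFinite (addClosure (leftPart A))

/-- `A` is (right) hereditary: every right ideal is projective. -/
def IsHereditary (A : Type*) [Ring A] : Prop :=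
  ∀ I : Submodule Aᵐᵒᵖ A, Module.Projective Aᵐᵒᵖ I

section Quiver

variable {A : Type u} [Ring A]

/-- A primitive idempotent: a nonzero idempotent that is not the sum of two nonzero orthogonal
idempotents. -/
def IsPrimitiveIdempotent (e : A) : Prop :=
  IsIdempotentElem e ∧ e ≠ 0 ∧
    ∀ f g : A, IsIdempotentElem f → IsIdempotentElem g → f * g = 0 → g * f = 0 → e = f + g →
      f = 0 ∨ g = 0

/-- The right ideal `eA`. -/
abbrev rightIdeal (e : A) : Submodule Aᵐᵒᵖ A := Submodule.span Aᵐᵒᵖ {e}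

variable (A) in
/-- Primitive idempotents `e`, `f` with `eA ≅ fA` are identified. -/
instance primitiveSetoid : Setoid {e : A // IsPrimitiveIdempotent e} where
  r e f := Nonempty (rightIdeal e.1 ≃ₗ[Aᵐᵒᵖ] rightIdeal f.1)
  iseqv := ⟨fun _ => ⟨LinearEquiv.refl _ _⟩, fun ⟨e⟩ => ⟨e.symm⟩, fun ⟨e⟩ ⟨f⟩ => ⟨e.trans f⟩⟩

variable (A) in
/-- The points of the valued quiver `Q_A`: the primitive idempotents `e_x` up to isomorphism of the
indecomposable projectives `e_x A`. -/
def QuiverPoint : Type u := _root_.Quotient (primitiveSetoid A)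

/-- There is an arrow `y ⟶ x` in the valued quiver `Q_A`, that is, `e_y J e_x / e_y J² e_x ≠ 0`
where `J` is the Jacobson radical. (The valuation of the arrow is not needed to speak of oriented
cycles.) -/
def HasArrow (y x : QuiverPoint A) : Prop :=
  ∃ e f : {e : A // IsPrimitiveIdempotent e}, (⟦e⟧ : QuiverPoint A) = y ∧ (⟦f⟧ : QuiverPoint A) = x ∧
    ∃ a ∈ Ring.jacobson A, e.1 * a * f.1 ∉ Ring.jacobson A * Ring.jacobson A

variable (A) in
/-- The valued quiver of `A` has no oriented cycles (loops count as cycles). -/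
def QuiverAcyclic : Prop := ∀ x : QuiverPoint A, ¬ Relation.TransGen HasArrow x x

variable (A) in
/-- `A` is basic: `1` is a sum of orthogonal primitive idempotents `e₁, …, e_n` such that the
modules `eᵢA` are pairwise nonisomorphic. -/
def IsBasic : Prop :=
  ∃ (n : ℕ) (e : Fin n → A), CompleteOrthogonalIdempotents e ∧
    (∀ i, IsPrimitiveIdempotent (e i)) ∧
    ∀ i j, i ≠ j → IsEmpty (rightIdeal (e i) ≃ₗ[Aᵐᵒᵖ] rightIdeal (e j))

end Quiver

end

end ArtinLeft

-- The left part is closed under predecessors, so `add(ℒ_A)` is closed under submodules with no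
-- further hypothesis: an indecomposable submodule of a member maps to it nonzero. The abelian exact
-- hypothesis enters only through `InAddLeftPart.quotient`: the cokernel of an inclusion `U → M`
-- between members, formed inside the subcategory, is the module `M / U`, so quotients stay in
-- `add(ℒ_A)`.
--
-- Everything else follows from these two closures. If `M` in `add(ℒ_A)` is projective and `U ≤ M`,
-- then `M / U` has projective dimension at most one, so `U` is projective
-- (`InAddLeftPart.projective_of_injective`). For the supporting projective this makes the
-- endomorphism ring hereditary (`isHereditary_end`). In any finitely generated `X` the images of
-- maps from `add(ℒ_A)` have a largest one, which again lies in `add(ℒ_A)`; its inclusion is the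
-- approximation (`exists_trace`).
--
-- If the quiver is acyclic, induct along its arrows: `eJ` is generated by images of the `fA` with
-- an arrow from `e` to `f`, so it sits in the trace of `A`, and then `eA` is in the left part
-- because a nonsurjective map to `eA` lands in `eJ`. Hence `A` itself is in `add(ℒ_A)` and is
-- hereditary; if basic, it is its own supporting projective, and `A ≅ End(A)`.

universe w w'

namespace ArtinLeft

/-! ### Indecomposable modules of finite length -/

section Indecomposable

variable {S : Type*} [Ring S]

/-- A nonzero module without a nontrivial pair of complementary submodules. -/
def IsIndecomposableModule (S : Type*) [Ring S] (M : Type*) [AddCommGroup M] [Module S M] : Prop :=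
  Nontrivial M ∧ ∀ U V : Submodule S M, IsCompl U V → U = ⊥ ∨ V = ⊥

variable {M : Type*} [AddCommGroup M] [Module S M] {N : Type*} [AddCommGroup N] [Module S N]

/-- Fitting's lemma: for large `n` the kernel and range of `f ^ n` are complementary, so one of them
vanishes. -/
theorem IsIndecomposableModule.isNilpotent_or_isUnit [IsArtinian S M] [IsNoetherian S M]
    (h : IsIndecomposableModule S M) (f : Module.End S M) : IsNilpotent f ∨ IsUnit f := by
  -- The bound `n ≥ 1` is needed for `ker f ≤ ker (f ^ n)`.
  obtain ⟨n, hn, hn1⟩ :=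
    (f.eventually_isCompl_ker_pow_range_pow.and (Filter.eventually_ge_atTop 1)).exists
  rcases h.2 _ _ hn with h0 | h0
  · refine Or.inr ((Module.End.isUnit_iff f).2 (IsArtinian.bijective_of_injective_endomorphism f ?_))
    rw [← LinearMap.ker_eq_bot, eq_bot_iff, ← h0]
    intro x hx
    obtain ⟨k, rfl⟩ : ∃ k, n = k + 1 := ⟨n - 1, by omega⟩
    rw [LinearMap.mem_ker] at hx ⊢
    rw [pow_succ, Module.End.mul_apply, hx, map_zero]
  · exact Or.inl ⟨n, LinearMap.range_eq_bot.1 h0⟩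

/-- In a ring whose elements are nilpotent or invertible, some term of an invertible finite sum is
invertible. -/
theorem exists_isUnit_of_isUnit_sum {E ι : Type*} [Ring E] [Nontrivial E]
    (hE : ∀ x : E, IsNilpotent x ∨ IsUnit x) (f : ι → E) (s : Finset ι)
    (h : IsUnit (∑ i ∈ s, f i)) : ∃ i ∈ s, IsUnit (f i) := by
  classical
  induction s using Finset.induction_on with
  | empty => simp at h
  | insert a s ha ih =>
    rw [Finset.sum_insert ha] at h
    obtain ⟨u, hu⟩ := h
    rcases hE (↑u⁻¹ * f a) with hn | hn
    · have h1 := hn.isUnit_one_sub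
      have h2 : 1 - ↑u⁻¹ * f a = ↑u⁻¹ * ∑ i ∈ s, f i := by
        rw [sub_eq_iff_eq_add, ← mul_add, add_comm, ← hu, Units.inv_mul]
      rw [h2, Units.isUnit_units_mul] at h1
      obtain ⟨i, hi, hi'⟩ := ih h1
      exact ⟨i, Finset.mem_insert_of_mem hi, hi'⟩
    · rw [Units.isUnit_units_mul] at hn
      exact ⟨a, Finset.mem_insert_self _ _, hn⟩

/-- Since `p ∘ i` is bijective, `range i` and `ker p` are complementary in `N`; indecomposability of
`N` kills the kernel. -/
theorem IsIndecomposableModule.bijective_of_isUnit_comp (hM : Nontrivial M)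
    (hN : IsIndecomposableModule S N) (i : M →ₗ[S] N) (p : N →ₗ[S] M)
    (h : IsUnit (p ∘ₗ i : Module.End S M)) : Function.Bijective i := by
  have hb := (Module.End.isUnit_iff _).1 h
  have hi : Function.Injective i := Function.Injective.of_comp (f := p) (by simpa using hb.1)
  have hc : IsCompl (LinearMap.range i) (LinearMap.ker p) := by
    constructor
    · rw [Submodule.disjoint_def]
      rintro _ ⟨x, rfl⟩ hx
      have : x = 0 := hb.1 (by simpa using hx)
      rw [this, map_zero]
    · rw [codisjoint_iff, eq_top_iff]
      intro y _
      obtain ⟨x, hx⟩ := hb.2 (p y)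
      refine Submodule.mem_sup.2 ⟨i x, ⟨x, rfl⟩, y - i x, ?_, by abel⟩
      rw [LinearMap.mem_ker, map_sub, ← hx]
      exact sub_self _
  rcases hN.2 _ _ hc with h0 | h0
  · exfalso
    obtain ⟨x, hx⟩ := exists_ne (0 : M)
    have : i = 0 := LinearMap.range_eq_bot.1 h0
    exact hx (hi (by rw [this]; simp))
  · refine ⟨hi, LinearMap.range_eq_top.1 ?_⟩
    simpa [h0] using hc.sup_eq_top

/-- An indecomposable module of finite length which is a direct summand of a finite direct sum of
indecomposable modules is isomorphic to one of them. -/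
theorem IsIndecomposableModule.exists_bijective [IsArtinian S M] [IsNoetherian S M]
    (hM : IsIndecomposableModule S M) {ι : Type*} [Fintype ι] {F : ι → Type*}
    [∀ k, AddCommGroup (F k)] [∀ k, Module S (F k)] (hF : ∀ k, IsIndecomposableModule S (F k))
    (i : ∀ k, M →ₗ[S] F k) (p : ∀ k, F k →ₗ[S] M) (h : ∑ k, p k ∘ₗ i k = LinearMap.id) :
    ∃ k, Function.Bijective (i k) := by
  have := hM.1
  obtain ⟨k, -, hk⟩ := exists_isUnit_of_isUnit_sum (E := Module.End S M)
    hM.isNilpotent_or_isUnit (fun k => p k ∘ₗ i k) Finset.univ (by rw [h]; exact isUnit_one)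
  exact ⟨k, (hF k).bijective_of_isUnit_comp hM.1 _ _ hk⟩

/-- A surjection from an indecomposable module onto a nonzero projective module is bijective. -/
theorem IsIndecomposableModule.bijective_of_surjective [Module.Projective S N] [Nontrivial N]
    (hM : IsIndecomposableModule S M) (f : M →ₗ[S] N) (hf : Function.Surjective f) :
    Function.Bijective f := by
  obtain ⟨s, hs⟩ := Module.projective_lifting_property f LinearMap.id hf
  have hb : Function.Bijective s := hM.bijective_of_isUnit_comp inferInstance s f
    (by rw [hs]; exact isUnit_one)
  refine ⟨fun x y hxy => ?_, hf⟩
  obtain ⟨x, rfl⟩ := hb.2 x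
  obtain ⟨y, rfl⟩ := hb.2 y
  have h := fun z => LinearMap.congr_fun hs z
  simp only [LinearMap.comp_apply, LinearMap.id_apply] at h
  rw [h, h] at hxy
  rw [hxy]

end Indecomposable

variable {A : Type u} [Ring A]

theorem isInd_iff (X : RMod A) : IsInd X ↔ IsIndecomposableModule Aᵐᵒᵖ X := by
  refine and_congr ?_ ⟨fun h U V hUV => ?_, fun h Y Z e => ?_⟩
  · rw [ModuleCat.isZero_iff_subsingleton, not_subsingleton_iff_nontrivial]
  · have := h (ModuleCat.of _ U) (ModuleCat.of _ V)
      ((Submodule.prodEquivOfIsCompl U V hUV).symm.toModuleIso ≪≫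
        (ModuleCat.biprodIsoProd (ModuleCat.of _ U) (ModuleCat.of _ V)).symm)
    simpa only [ModuleCat.isZero_iff_subsingleton, Submodule.subsingleton_iff_eq_bot] using this
  · let e' : X ≃ₗ[Aᵐᵒᵖ] (Y × Z) := (e ≪≫ ModuleCat.biprodIsoProd Y Z).toLinearEquiv
    have := h _ _ ((LinearMap.isCompl_range_inl_inr (R := Aᵐᵒᵖ) (M := Y) (M₂ := Z)).map
      (Submodule.orderIsoMapComap e'.symm))
    simp only [map_eq_bot_iff, LinearMap.range_eq_bot] at this
    refine this.imp (fun h0 => ?_) (fun h0 => ?_) <;>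
    · rw [ModuleCat.isZero_iff_subsingleton]
      refine ⟨fun a b => ?_⟩
      have h1 := LinearMap.congr_fun h0 a
      have h2 := LinearMap.congr_fun h0 b
      simp at h1 h2
      rw [h1, h2]

/-! ### Direct sums of modules of the left part -/

theorem Step.of_ne_zero {X Y : RMod A} (hX : IsInd X) (hY : IsInd Y) (f : X →ₗ[Aᵐᵒᵖ] Y)
    (hf : f ≠ 0) : Step X Y := ⟨hX, hY, f, hf⟩

theorem leftPart_of_isPredecessor {X Y : RMod A} (hX : IsInd X) (h : IsPredecessor X Y)
    (hY : leftPart A Y) : leftPart A X :=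
  ⟨hX, fun Z hZ => hY.2 Z (hZ.trans h)⟩

theorem leftPart_of_ne_zero {X Y : RMod A} (hX : IsInd X) (hY : leftPart A Y)
    (f : X →ₗ[Aᵐᵒᵖ] Y) (hf : f ≠ 0) : leftPart A X :=
  leftPart_of_isPredecessor hX (.single (.of_ne_zero hX hY.1 f hf)) hY

theorem sum_comp_comp_comp {S : Type*} [Ring S] {ι : Type*} {s : Finset ι} {F : ι → Type*}
    {X Y Z W : Type*} [∀ k, AddCommGroup (F k)] [∀ k, Module S (F k)] [AddCommGroup X]
    [Module S X] [AddCommGroup Y] [Module S Y] [AddCommGroup Z] [Module S Z] [AddCommGroup W]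
    [Module S W] (i : X →ₗ[S] Y) (j : ∀ k, Y →ₗ[S] F k) (q : ∀ k, F k →ₗ[S] Z) (p : Z →ₗ[S] W) :
    ∑ k ∈ s, (p ∘ₗ q k) ∘ₗ (j k ∘ₗ i) = p ∘ₗ (∑ k ∈ s, q k ∘ₗ j k) ∘ₗ i := by
  ext x
  simp [LinearMap.sum_apply]

variable (A) in
/-- A module, in any universe, which is a direct summand of a finite direct sum of modules of the
left part. -/
def InAddLeftPart (M : Type w) [AddCommGroup M] [Module Aᵐᵒᵖ M] : Prop :=
  ∃ (n : ℕ) (F : Fin n → RMod A), (∀ k, leftPart A (F k)) ∧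
    ∃ (i : ∀ k, M →ₗ[Aᵐᵒᵖ] F k) (p : ∀ k, F k →ₗ[Aᵐᵒᵖ] M), ∑ k, p k ∘ₗ i k = LinearMap.id

section InAddLeftPart

variable {M : Type w} [AddCommGroup M] [Module Aᵐᵒᵖ M]
  {N : Type w'} [AddCommGroup N] [Module Aᵐᵒᵖ N]

theorem addClosure_iff (X : RMod A) : addClosure (leftPart A) X ↔ InAddLeftPart A X := by
  refine exists_congr fun n => exists_congr fun F => and_congr_right fun hF => ⟨?_, ?_⟩
  · rintro ⟨i, p, h⟩
    refine ⟨fun k => DirectSum.component _ _ _ k ∘ₗ i, fun k => p ∘ₗ DirectSum.lof Aᵐᵒᵖ _ (fun k => F k) k, ?_⟩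
    rw [← h]
    ext x
    have hx : ∑ k, DirectSum.lof Aᵐᵒᵖ (Fin n) (fun k => F k) k (i x k) = i x :=
      DirectSum.sum_univ_of (i x)
    simp only [LinearMap.sum_apply, LinearMap.comp_apply] at *
    conv_rhs => rw [← hx, map_sum]
    rfl
  · rintro ⟨i, p, h⟩
    refine ⟨∑ k, DirectSum.lof _ _ _ k ∘ₗ i k, DirectSum.toModule _ _ _ p, ?_⟩
    rw [← h]
    ext x
    simp [LinearMap.sum_apply, DirectSum.toModule_lof]

theorem InAddLeftPart.of_fintype {ι : Type*} [Fintype ι] (F : ι → RMod A)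
    (hF : ∀ k, leftPart A (F k)) (i : ∀ k, M →ₗ[Aᵐᵒᵖ] F k) (p : ∀ k, F k →ₗ[Aᵐᵒᵖ] M)
    (h : ∑ k, p k ∘ₗ i k = LinearMap.id) : InAddLeftPart A M := by
  let e := (Fintype.equivFin ι).symm
  refine ⟨_, fun k => F (e k), fun k => hF _, fun k => i (e k), fun k => p (e k), ?_⟩
  rw [← h]
  exact e.sum_comp (fun k => p k ∘ₗ i k)

theorem InAddLeftPart.of_retract (hN : InAddLeftPart A N) (i : M →ₗ[Aᵐᵒᵖ] N) (p : N →ₗ[Aᵐᵒᵖ] M)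
    (h : p ∘ₗ i = LinearMap.id) : InAddLeftPart A M := by
  obtain ⟨n, F, hF, j, q, hjq⟩ := hN
  refine ⟨n, F, hF, fun k => j k ∘ₗ i, fun k => p ∘ₗ q k, ?_⟩
  rw [sum_comp_comp_comp, hjq, LinearMap.id_comp, h]

theorem InAddLeftPart.of_equiv (hN : InAddLeftPart A N) (e : M ≃ₗ[Aᵐᵒᵖ] N) : InAddLeftPart A M :=
  hN.of_retract e.toLinearMap e.symm.toLinearMap (by ext; simp)

theorem InAddLeftPart.of_sum {ι : Type*} [Fintype ι] (G : ι → Type w') [∀ k, AddCommGroup (G k)]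
    [∀ k, Module Aᵐᵒᵖ (G k)] (hG : ∀ k, InAddLeftPart A (G k))
    (i : ∀ k, M →ₗ[Aᵐᵒᵖ] G k) (p : ∀ k, G k →ₗ[Aᵐᵒᵖ] M)
    (h : ∑ k, p k ∘ₗ i k = LinearMap.id) : InAddLeftPart A M := by
  choose n F hF j q hjq using hG
  refine .of_fintype (ι := Σ k, Fin (n k)) (fun x => F x.1 x.2) (fun x => hF _ _)
    (fun x => j x.1 x.2 ∘ₗ i x.1) (fun x => p x.1 ∘ₗ q x.1 x.2) ?_
  rw [← h, Fintype.sum_sigma]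
  refine Finset.sum_congr rfl fun k _ => ?_
  exact (sum_comp_comp_comp (i k) (j k) (q k) (p k)).trans (by rw [hjq, LinearMap.id_comp])

theorem InAddLeftPart.pi {ι : Type*} [Fintype ι] (G : ι → Type w') [∀ k, AddCommGroup (G k)]
    [∀ k, Module Aᵐᵒᵖ (G k)] (hG : ∀ k, InAddLeftPart A (G k)) :
    InAddLeftPart A (∀ k, G k) := by
  classical
  refine .of_sum G hG (fun k => LinearMap.proj k) (fun k => LinearMap.single _ _ k) ?_
  ext x k
  simp [Finset.sum_apply]

theorem InAddLeftPart.prod {N : Type w} [AddCommGroup N] [Module Aᵐᵒᵖ N] (hM : InAddLeftPart A M)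
    (hN : InAddLeftPart A N) : InAddLeftPart A (M × N) := by
  obtain ⟨m, F, hF, i, p, hip⟩ := hM
  obtain ⟨n, G, hG, j, q, hjq⟩ := hN
  refine .of_fintype (ι := Fin m ⊕ Fin n) (Sum.elim F G) (by rintro (k | k) <;> simp [hF, hG])
    (Sum.rec (fun k => i k ∘ₗ LinearMap.fst _ _ _) (fun k => j k ∘ₗ LinearMap.snd _ _ _))
    (Sum.rec (fun k => LinearMap.inl _ _ _ ∘ₗ p k) (fun k => LinearMap.inr _ _ _ ∘ₗ q k)) ?_
  rw [Fintype.sum_sum_type]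
  refine (congrArg₂ (· + ·) (sum_comp_comp_comp (LinearMap.fst Aᵐᵒᵖ M N) i p (LinearMap.inl Aᵐᵒᵖ M N))
    (sum_comp_comp_comp (LinearMap.snd Aᵐᵒᵖ M N) j q (LinearMap.inr Aᵐᵒᵖ M N))).trans ?_
  rw [hip, hjq]
  ext x <;> simp

theorem inAddLeftPart_of_leftPart {X : RMod A} (hX : leftPart A X) : InAddLeftPart A X :=
  .of_fintype (ι := Unit) (fun _ => X) (fun _ => hX) (fun _ => LinearMap.id)
    (fun _ => LinearMap.id) (by ext; simp)

theorem InAddLeftPart.of_subsingleton [Subsingleton M] : InAddLeftPart A M :=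
  .of_fintype (ι := Empty) Empty.elim (fun k => k.elim) (fun k => k.elim) (fun k => k.elim)
    (by ext; exact Subsingleton.elim _ _)

theorem InAddLeftPart.leftPart_of_ne_zero (hM : InAddLeftPart A M) {X : RMod A} (hX : IsInd X)
    (f : X →ₗ[Aᵐᵒᵖ] M) (hf : f ≠ 0) : leftPart A X := by
  obtain ⟨n, F, hF, i, p, h⟩ := hM
  obtain ⟨k, hk⟩ : ∃ k, i k ∘ₗ f ≠ 0 := by
    by_contra! h0
    apply hf
    rw [← LinearMap.id_comp f, ← h]
    ext x
    have h1 := fun k => LinearMap.congr_fun (h0 k) x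
    simp only [LinearMap.comp_apply, LinearMap.zero_apply] at h1
    simp [h1]
  exact ArtinLeft.leftPart_of_ne_zero hX (hF k) _ hk

theorem InAddLeftPart.moduleFinite (hM : InAddLeftPart A M) : Module.Finite Aᵐᵒᵖ M := by
  classical
  obtain ⟨n, F, hF, i, p, h⟩ := hM
  refine Module.Finite.of_surjective
    (∑ k, p k ∘ₗ LinearMap.proj k : (∀ k, F k) →ₗ[Aᵐᵒᵖ] M) fun x => ⟨fun k => i k x, ?_⟩
  simpa [LinearMap.sum_apply] using LinearMap.congr_fun h x

end InAddLeftPart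

/-- Direct sums of modules of the left part have projective dimension at most one. -/
theorem InAddLeftPart.hasProjectiveDimensionLE {M : Type u} [AddCommGroup M] [Module Aᵐᵒᵖ M]
    (hM : InAddLeftPart A M) : HasProjectiveDimensionLE (ModuleCat.of Aᵐᵒᵖ M) 1 := by
  obtain ⟨n, F, hF, i, p, h⟩ := hM
  let := HasExt.standard (ModuleCat.{u} Aᵐᵒᵖ)
  rw [HasProjectiveDimensionLE, hasProjectiveDimensionLT_iff]
  intro m hm Y e
  have key : 𝟙 (ModuleCat.of Aᵐᵒᵖ M) =
      ∑ k, (ModuleCat.ofHom (i k) : ModuleCat.of Aᵐᵒᵖ M ⟶ (F k).obj) ≫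
        (ModuleCat.ofHom (p k) : (F k).obj ⟶ ModuleCat.of Aᵐᵒᵖ M) := by
    ext x
    rw [ModuleCat.hom_sum]
    simpa [LinearMap.sum_apply] using (LinearMap.congr_fun h x).symm
  -- The identity of `M` factors through the `F k`, so a class in degree `m ≥ 2` is a sum of classes
  -- each passing through `Ext^m(F k, Y) = 0`.
  rw [← e.mk₀_id_comp, key, Abelian.Ext.mk₀_sum, Abelian.Ext.sum_comp]
  refine Finset.sum_eq_zero fun k _ => ?_
  have := (hF k).2 (F k) .refl
  rw [← Abelian.Ext.mk₀_comp_mk₀, Abelian.Ext.comp_assoc _ _ _ _ (zero_add m) (by simp),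
    ((Abelian.Ext.mk₀ _).comp e (zero_add m)).eq_zero_of_hasProjectiveDimensionLT 2 hm,
    Abelian.Ext.comp_zero]

/-! ### Closure of `add(ℒ_A)` under submodules and quotients, and its consequences -/

section Artinian

variable [IsArtinianRing Aᵐᵒᵖ]

/-- `add(ℒ_A)` is closed under submodules. -/
theorem InAddLeftPart.submodule {M : Type u} [AddCommGroup M] [Module Aᵐᵒᵖ M]
    (hM : InAddLeftPart A M) (U : Submodule Aᵐᵒᵖ M) : InAddLeftPart A U := by
  have := hM.moduleFinite
  -- `M` is finitely generated over an artinian ring, so its submodules satisfy the descending chain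
  -- condition; a decomposable `U` splits into two strictly smaller submodules.
  induction U using WellFoundedLT.induction with
  | ind U ih =>
  by_cases hU : Subsingleton U
  · exact .of_subsingleton
  rw [not_subsingleton_iff_nontrivial] at hU
  by_cases hI : IsIndecomposableModule Aᵐᵒᵖ U
  · have hI' : IsInd (FGModuleCat.of Aᵐᵒᵖ U) := (isInd_iff _).2 hI
    refine inAddLeftPart_of_leftPart (hM.leftPart_of_ne_zero hI' U.subtype fun h => ?_)
    obtain ⟨x, hx⟩ := exists_ne (0 : U)
    exact hx (Subtype.ext (LinearMap.congr_fun h x))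
  · rw [IsIndecomposableModule, not_and] at hI
    have h2 := hI hU
    push Not at h2
    obtain ⟨V, W, hVW, hV, hW⟩ := h2
    have key : ∀ V W : Submodule Aᵐᵒᵖ U, IsCompl V W → W ≠ ⊥ → InAddLeftPart A V := by
      intro V W hVW hW
      have hlt : V.map U.subtype < U := by
        have h1 : V < ⊤ := lt_top_iff_ne_top.2 fun h => hW (by simpa [h] using hVW.inf_eq_bot)
        have := Submodule.map_strictMono_of_injective U.subtype_injective h1
        simpa using this
      exact (ih _ hlt).of_equiv (V.equivMapOfInjective _ U.subtype_injective)
    exact ((key V W hVW hW).prod (key W V hVW.symm hV)).of_equiv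
      (Submodule.prodEquivOfIsCompl V W hVW).symm

theorem InAddLeftPart.of_injective {M : Type u} [AddCommGroup M] [Module Aᵐᵒᵖ M]
    {N : Type w} [AddCommGroup N] [Module Aᵐᵒᵖ N]
    (hM : InAddLeftPart A M) (f : N →ₗ[Aᵐᵒᵖ] M) (hf : Function.Injective f) : InAddLeftPart A N :=
  (hM.submodule (LinearMap.range f)).of_equiv (LinearEquiv.ofInjective f hf)

/-- The abelian structure on `𝒞` is arbitrary, so `G` is not assumed additive; fullness already
makes it preserve zero morphisms, which is enough for it to preserve cokernels. -/
theorem exists_iso_cokernel_map {𝒞 𝒟 : Type*} [Category* 𝒞] [Category* 𝒟] [Abelian 𝒞] [Abelian 𝒟]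
    (G : 𝒞 ⥤ 𝒟) [G.Full] [PreservesFiniteColimits G] {X Y : 𝒞} (f : X ⟶ Y) :
    ∃ Q : 𝒞, Nonempty (G.obj Q ≅ cokernel (G.map f)) :=
  ⟨cokernel f, ⟨PreservesCokernel.iso G f⟩⟩

/-- If `add(ℒ_A)` is an abelian exact subcategory, then it is closed under quotients. -/
theorem InAddLeftPart.quotient (hA : IsAbelianExact (addClosure (leftPart A)))
    {M : Type u} [AddCommGroup M] [Module Aᵐᵒᵖ M] (hM : InAddLeftPart A M)
    (U : Submodule Aᵐᵒᵖ M) : InAddLeftPart A (M ⧸ U) := by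
  obtain ⟨⟨hab⟩, -, hcol⟩ := hA
  have := hM.moduleFinite
  set C := addClosure (leftPart A)
  let D : C.FullSubcategory := ⟨FGModuleCat.of Aᵐᵒᵖ M, (addClosure_iff _).2 hM⟩
  let K : C.FullSubcategory := ⟨FGModuleCat.of Aᵐᵒᵖ U, (addClosure_iff _).2 (hM.submodule U)⟩
  let f : K ⟶ D := ObjectProperty.homMk (FGModuleCat.ofHom U.subtype)
  obtain ⟨Q, ⟨e⟩⟩ := exists_iso_cokernel_map C.ι f
  let e' := (forget₂ (FGModuleCat Aᵐᵒᵖ) (ModuleCat Aᵐᵒᵖ)).mapIso e ≪≫ PreservesCokernel.iso _ _ ≪≫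
    ModuleCat.cokernelIsoRangeQuotient
      ((forget₂ (FGModuleCat Aᵐᵒᵖ) (ModuleCat Aᵐᵒᵖ)).map (C.ι.map f))
  have hr : LinearMap.range ((forget₂ (FGModuleCat Aᵐᵒᵖ) (ModuleCat Aᵐᵒᵖ)).map (C.ι.map f)).hom = U :=
    U.range_subtype
  exact ((addClosure_iff _).1 Q.property).of_equiv
    ((Submodule.quotEquivOfEq _ _ hr.symm).trans e'.symm.toLinearEquiv)

theorem InAddLeftPart.of_surjective (hA : IsAbelianExact (addClosure (leftPart A)))
    {M : Type u} [AddCommGroup M] [Module Aᵐᵒᵖ M] {N : Type w} [AddCommGroup N] [Module Aᵐᵒᵖ N]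
    (hM : InAddLeftPart A M) (f : M →ₗ[Aᵐᵒᵖ] N) (hf : Function.Surjective f) :
    InAddLeftPart A N :=
  (hM.quotient hA (LinearMap.ker f)).of_equiv (f.quotKerEquivOfSurjective hf).symm

/-- If `add(ℒ_A)` is an abelian exact subcategory, then the submodules of a projective module in it
are projective. -/
theorem InAddLeftPart.projective_of_injective (hA : IsAbelianExact (addClosure (leftPart A)))
    {M : Type w} [AddCommGroup M] [Module Aᵐᵒᵖ M] [Module.Projective Aᵐᵒᵖ M]
    (hM : InAddLeftPart A M) (U : Submodule Aᵐᵒᵖ M) : Module.Projective Aᵐᵒᵖ U := by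
  -- The supporting projective lives in a larger universe; embedding `M` into the product of the `F
  -- k` gives a copy in `Type u`, where the homological lemmas apply.
  obtain ⟨M', _, _, ⟨e⟩⟩ : ∃ (M' : Type u) (_ : AddCommGroup M') (_ : Module Aᵐᵒᵖ M'),
      Nonempty (M ≃ₗ[Aᵐᵒᵖ] M') := by
    obtain ⟨n, F, hF, i, p, h⟩ := hM
    refine ⟨_, _, _, ⟨LinearEquiv.ofInjective (LinearMap.pi i) fun x y hxy => ?_⟩⟩
    rw [← LinearMap.id_apply (R := Aᵐᵒᵖ) x, ← LinearMap.id_apply (R := Aᵐᵒᵖ) y, ← h]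
    have := congrFun hxy
    simp only [LinearMap.pi_apply] at this
    simp [LinearMap.sum_apply, this]
  have : Module.Projective Aᵐᵒᵖ M' := .of_equiv e
  have hM' : InAddLeftPart A M' := hM.of_equiv e.symm
  set U' := U.map e.toLinearMap
  have hU' : HasProjectiveDimensionLT (ModuleCat.of Aᵐᵒᵖ U') 1 := by
    have hpd := (hM'.quotient hA U').hasProjectiveDimensionLE
    have hex := LinearMap.shortExact_shortComplexKer U'.mkQ_surjective
    have hproj : Projective (ModuleCat.of Aᵐᵒᵖ M') := (IsProjective.iff_projective _).1 this
    -- Dimension shift in `0 → U' → M' → M' / U' → 0`: the middle term has dimension `< 1` and the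
    -- quotient dimension `< 2`.
    have h1 := hex.hasProjectiveDimensionLT_X₁ 1
      (projective_iff_hasProjectiveDimensionLT_one.1 hproj) hpd
    have := Submodule.ker_mkQ U'
    exact (hasProjectiveDimensionLT_of_iso
      (LinearEquiv.toModuleIso (LinearEquiv.ofEq _ _ this)) 1)
  have : Module.Projective Aᵐᵒᵖ U' :=
    (IsProjective.iff_projective _).2 (projective_iff_hasProjectiveDimensionLT_one.2 hU')
  exact .of_equiv (e.submoduleMap U).symm

/-- If `add(ℒ_A)` is an abelian exact subcategory, then every finitely generated module has a largest
submodule lying in it, containing the images of all morphisms from `add(ℒ_A)`. -/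
theorem exists_trace (hA : IsAbelianExact (addClosure (leftPart A))) (X : Type u) [AddCommGroup X]
    [Module Aᵐᵒᵖ X] [Module.Finite Aᵐᵒᵖ X] :
    ∃ U : Submodule Aᵐᵒᵖ X, InAddLeftPart A U ∧
      ∀ (E : RMod A) (g : E →ₗ[Aᵐᵒᵖ] X), InAddLeftPart A E → LinearMap.range g ≤ U := by
  obtain ⟨U, ⟨D, hD, f, rfl⟩, hmax⟩ := wellFounded_gt.has_min
    {U : Submodule Aᵐᵒᵖ X | ∃ D : RMod A, InAddLeftPart A D ∧ ∃ f : D →ₗ[Aᵐᵒᵖ] X,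
      LinearMap.range f = U}
    ⟨_, FGModuleCat.of Aᵐᵒᵖ PUnit, .of_subsingleton, 0, rfl⟩
  refine ⟨LinearMap.range f, hD.of_surjective hA f.rangeRestrict f.surjective_rangeRestrict,
    fun E g hE => ?_⟩
  by_contra hlt
  -- If `range g` were not inside the maximal image, the map from `D × E` would have a strictly
  -- larger one.
  refine hmax (LinearMap.range (f.coprod g))
    ⟨FGModuleCat.of Aᵐᵒᵖ (D × E), hD.prod hE, f.coprod g, rfl⟩ ?_
  rw [LinearMap.range_coprod]
  exact left_lt_sup.2 hlt

/-- If `add(ℒ_A)` is an abelian exact subcategory, then it is contravariantly finite. -/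
theorem isLeftSupported_of_isAbelianExact (hA : IsAbelianExact (addClosure (leftPart A))) :
    IsLeftSupported A := by
  intro X
  obtain ⟨U, hU, hmem⟩ := exists_trace hA X
  refine ⟨FGModuleCat.of Aᵐᵒᵖ U, FGModuleCat.ofHom U.subtype, (addClosure_iff _).2 hU,
    fun E g hE => ?_⟩
  have hg := hmem E g.hom.hom ((addClosure_iff _).1 hE)
  exact ⟨FGModuleCat.ofHom (LinearMap.codRestrict _ g.hom.hom fun x => hg ⟨x, rfl⟩), rfl⟩

end Artinian

/-! ### Primitive idempotents and indecomposable projectives -/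

section Idempotents

variable {A : Type u} [Ring A]

variable (A) in
/-- A ring is free of rank one as a right module over itself. -/
def opSelfEquiv : A ≃ₗ[Aᵐᵒᵖ] Aᵐᵒᵖ where
  toFun := MulOpposite.op
  invFun := MulOpposite.unop
  map_add' _ _ := rfl
  map_smul' _ _ := rfl
  left_inv _ := rfl
  right_inv _ := rfl

instance : Module.Projective Aᵐᵒᵖ A := .of_equiv (opSelfEquiv A).symm

instance : Module.Finite Aᵐᵒᵖ A := .equiv (opSelfEquiv A).symm

theorem mem_rightIdeal {e : A} {x : A} : x ∈ rightIdeal e ↔ ∃ a, e * a = x := by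
  rw [Submodule.mem_span_singleton]
  exact ⟨fun ⟨a, h⟩ => ⟨a.unop, h⟩, fun ⟨a, h⟩ => ⟨.op a, h⟩⟩

theorem mem_rightIdeal_iff {e : A} (he : IsIdempotentElem e) {x : A} :
    x ∈ rightIdeal e ↔ e * x = x := by
  rw [mem_rightIdeal]
  refine ⟨?_, fun h => ⟨x, h⟩⟩
  rintro ⟨a, rfl⟩
  rw [← mul_assoc, he]

/-- Left multiplication by `e` as a map onto `eA`. -/
def toRightIdeal (e : A) : A →ₗ[Aᵐᵒᵖ] rightIdeal e :=
  (LinearMap.mulLeft Aᵐᵒᵖ e).codRestrict _ fun x => mem_rightIdeal.2 ⟨x, rfl⟩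

@[simp]
theorem coe_toRightIdeal (e x : A) : (toRightIdeal e x : A) = e * x := rfl

theorem toRightIdeal_comp_subtype {e : A} (he : IsIdempotentElem e) :
    toRightIdeal e ∘ₗ (rightIdeal e).subtype = LinearMap.id := by
  ext ⟨x, hx⟩
  exact (mem_rightIdeal_iff he).1 hx

theorem projective_rightIdeal {e : A} (he : IsIdempotentElem e) :
    Module.Projective Aᵐᵒᵖ (rightIdeal e) :=
  .of_split _ _ (toRightIdeal_comp_subtype he)

/-- Writing `e = u + v` along a decomposition `U ⊕ V` of `eA` gives orthogonal idempotents, since `u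
- u * u = v * u` lies in `U ∩ V`. If `u = 0`, then `e ∈ V` and `U = 0`. -/
theorem IsPrimitiveIdempotent.isIndecomposableModule {e : A} (he : IsPrimitiveIdempotent e) :
    IsIndecomposableModule Aᵐᵒᵖ (rightIdeal e) := by
  obtain ⟨hid, h0, h⟩ := he
  have hmem := @mem_rightIdeal_iff _ _ e hid
  have hee : e ∈ rightIdeal e := Submodule.mem_span_singleton_self e
  refine ⟨⟨⟨e, hee⟩, 0, fun h' => h0 (congrArg Subtype.val h')⟩, fun U V hUV => ?_⟩
  obtain ⟨u, hu, v, hv, huv⟩ := Submodule.mem_sup.1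
    (show (⟨e, hee⟩ : rightIdeal e) ∈ U ⊔ V by rw [hUV.sup_eq_top]; trivial)
  have huv' : (u : A) + v = e := congrArg Subtype.val huv
  have hdis := Submodule.disjoint_def.1 hUV.disjoint
  have aux : ∀ {U V : Submodule Aᵐᵒᵖ (rightIdeal e)} {u v : rightIdeal e}, u ∈ U → v ∈ V →
      (u : A) + v = e → (∀ x ∈ U, x ∈ V → x = 0) → (u : A) * u = u ∧ (v : A) * u = 0 := by
    intro U V u v hu hv huv hdis
    have h1 : (u : A) - u * u = v * u := by
      have h2 : ((u : A) + v) * u = u := (congrArg (· * (u : A)) huv).trans (hmem.1 u.2)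
      rw [add_mul] at h2
      exact sub_eq_iff_eq_add'.2 h2.symm
    have h3 : u - MulOpposite.op (u : A) • u = MulOpposite.op (u : A) • v := Subtype.ext h1
    have h4 := hdis _ (U.sub_mem hu (U.smul_mem _ hu)) (h3 ▸ V.smul_mem _ hv)
    have h5 : (u : A) - u * u = 0 := congrArg Subtype.val h4
    exact ⟨(sub_eq_zero.1 h5).symm, h1.symm.trans h5⟩
  obtain ⟨hu2, hvu⟩ := aux hu hv huv' hdis
  obtain ⟨hv2, huv0⟩ := aux hv hu (by rw [add_comm]; exact huv') (fun x h1 h2 => hdis x h2 h1)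
  have key : ∀ {U V : Submodule Aᵐᵒᵖ (rightIdeal e)} {u v : rightIdeal e}, v ∈ V →
      (u : A) + v = e → (∀ x ∈ U, x ∈ V → x = 0) → (u : A) = 0 → U = ⊥ := by
    intro U V u v hv huv hdis hu
    rw [hu, zero_add] at huv
    refine (Submodule.eq_bot_iff _).2 fun x hx => hdis x hx ?_
    have : x = MulOpposite.op (x : A) • v := by
      refine Subtype.ext ?_
      change (x : A) = v * x
      rw [huv, hmem.1 x.2]
    rw [this]
    exact V.smul_mem _ hv
  rcases h u v hu2 hv2 huv0 hvu huv'.symm with h' | h'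
  · exact Or.inl (key hv huv' hdis h')
  · exact Or.inr (key hu (by rw [add_comm]; exact huv') (fun x h1 h2 => hdis x h2 h1) h')

section Artinian

variable [IsArtinianRing Aᵐᵒᵖ]

/-- In an artinian ring, every idempotent is a finite sum of primitive idempotents. -/
theorem exists_sum_isPrimitiveIdempotent (e : A) (he : IsIdempotentElem e) :
    ∃ (ι : Type) (_ : Fintype ι) (f : ι → A), (∀ i, IsPrimitiveIdempotent (f i)) ∧
      ∑ i, f i = e := by
  -- Splitting `e = f + g` into nonzero orthogonal idempotents strictly shrinks the right ideal.
  induction h : rightIdeal e using WellFoundedLT.induction generalizing e with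
  | ind U ih =>
  subst h
  by_cases h0 : e = 0
  · exact ⟨Empty, inferInstance, Empty.elim, fun i => i.elim, by simp [h0]⟩
  by_cases hp : IsPrimitiveIdempotent e
  · exact ⟨Unit, inferInstance, fun _ => e, fun _ => hp, by simp⟩
  · simp only [IsPrimitiveIdempotent, not_and] at hp
    have h2 := hp he h0
    push Not at h2
    obtain ⟨f, g, hf, hg, hfg, hgf, rfl, hf0, hg0⟩ := h2
    have key : ∀ f g : A, IsIdempotentElem f → IsIdempotentElem g → f * g = 0 → g * f = 0 →
        g ≠ 0 → rightIdeal f < rightIdeal (f + g) := by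
      intro f g hf hg hfg hgf hg0
      refine lt_of_le_of_ne ?_ fun heq => hg0 ?_
      · refine Submodule.span_le.2 (Set.singleton_subset_iff.2 (mem_rightIdeal.2 ⟨f, ?_⟩))
        rw [add_mul, hgf, add_zero, hf]
      · have hg' : g ∈ rightIdeal (f + g) :=
          mem_rightIdeal.2 ⟨g, by rw [add_mul, hfg, zero_add, hg]⟩
        rw [← heq, mem_rightIdeal_iff hf, hfg] at hg'
        exact hg'.symm
    obtain ⟨ι, _, a, ha, hsa⟩ := ih _ (key f g hf hg hfg hgf hg0) f hf rfl
    obtain ⟨κ, _, b, hb, hsb⟩ := ih _ (add_comm f g ▸ key g f hg hf hgf hfg hf0) g hg rfl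
    exact ⟨ι ⊕ κ, inferInstance, Sum.elim a b, by rintro (i | i) <;> simp [ha, hb],
      by simp [Fintype.sum_sum_type, hsa, hsb]⟩

/-- Every finitely generated indecomposable projective module is isomorphic to one of the `fᵢA`, if
`1` is the sum of the primitive idempotents `fᵢ`. -/
theorem exists_equiv_rightIdeal {ι : Type*} [Fintype ι] (f : ι → A)
    (hf : ∀ i, IsPrimitiveIdempotent (f i)) (hsum : ∑ i, f i = 1) {X : Type w} [AddCommGroup X]
    [Module Aᵐᵒᵖ X] [Module.Finite Aᵐᵒᵖ X] [Module.Projective Aᵐᵒᵖ X]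
    (hX : IsIndecomposableModule Aᵐᵒᵖ X) : ∃ i, Nonempty (X ≃ₗ[Aᵐᵒᵖ] rightIdeal (f i)) := by
  classical
  obtain ⟨n, π, hπ⟩ := Module.Finite.exists_fin' Aᵐᵒᵖ X
  obtain ⟨s, hs⟩ := Module.projective_lifting_property π LinearMap.id hπ
  -- `X` is a summand of a free module of rank `n`, each of whose coordinates splits into the `fᵢA`.
  obtain ⟨⟨k, i⟩, hi⟩ := hX.exists_bijective (ι := Fin n × ι)
    (F := fun x => rightIdeal (f x.2)) (fun x => (hf x.2).isIndecomposableModule)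
    (fun x => toRightIdeal (f x.2) ∘ₗ (opSelfEquiv A).symm.toLinearMap ∘ₗ LinearMap.proj x.1 ∘ₗ s)
    (fun x => π ∘ₗ LinearMap.single _ _ x.1 ∘ₗ (opSelfEquiv A).toLinearMap ∘ₗ
      (rightIdeal (f x.2)).subtype) (by
    ext x
    conv_rhs => rw [← hs]
    simp only [LinearMap.sum_apply, LinearMap.comp_apply]
    rw [← map_sum]
    congr 1
    rw [Fintype.sum_prod_type]
    simp only [← map_sum, Submodule.subtype_apply, coe_toRightIdeal, ← Finset.sum_mul, hsum, one_mul]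
    simp [Finset.univ_sum_single])
  exact ⟨i, ⟨LinearEquiv.ofBijective _ hi⟩⟩

/-- Makes the supporting projective a finite direct sum, hence finitely generated. -/
theorem finite_quotient_indProjSetoid (C : ObjectProperty (RMod A)) :
    Finite (_root_.Quotient (indProjSetoid C)) := by
  obtain ⟨ι, _, f, hf, hsum⟩ := exists_sum_isPrimitiveIdempotent (1 : A) .one
  have h : ∀ q : _root_.Quotient (indProjSetoid C),
      ∃ i, Nonempty (q.out.1 ≃ₗ[Aᵐᵒᵖ] rightIdeal (f i)) := fun q =>
    have := q.out.2.2.2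
    exists_equiv_rightIdeal f hf hsum ((isInd_iff _).1 q.out.2.1)
  choose σ hσ using h
  refine Finite.of_injective σ fun q r hqr => ?_
  obtain ⟨a⟩ := hσ q
  obtain ⟨b⟩ := hσ r
  rw [← hqr] at b
  rw [← Quotient.out_eq q, ← Quotient.out_eq r]
  exact Quotient.sound ⟨a.trans b.symm⟩

theorem finite_quiverPoint : Finite (QuiverPoint A) := by
  obtain ⟨ι, _, f, hf, hsum⟩ := exists_sum_isPrimitiveIdempotent (1 : A) .one
  refine Finite.of_surjective (fun i : ι => (⟦⟨f i, hf i⟩⟧ : QuiverPoint A)) fun q => ?_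
  induction q using Quotient.inductionOn with
  | h e =>
  have := projective_rightIdeal e.2.1
  obtain ⟨i, ⟨a⟩⟩ := exists_equiv_rightIdeal f hf hsum e.2.isIndecomposableModule
  exact ⟨i, Quotient.sound ⟨a.symm⟩⟩

end Artinian

end Idempotents

/-! ### The left support is hereditary -/

/-- If the submodules of a noetherian module `P` are projective, then its endomorphism ring is
hereditary. -/
theorem isHereditary_end {S : Type*} [Ring S] {P : Type*} [AddCommGroup P] [Module S P]
    [IsNoetherian S P] (hP : ∀ U : Submodule S P, Module.Projective S U) :
    IsHereditary (Module.End S P) := by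
  intro I
  -- `M = I · P` is already the sum of the ranges of finitely many `f ∈ I`, so some `P ^ s` surjects
  -- onto `M`.
  let M : Submodule S P := ⨆ f : I, LinearMap.range (f : Module.End S P)
  obtain ⟨s, hs⟩ : ∃ s : Finset I, M ≤ ⨆ f ∈ s, LinearMap.range (f : Module.End S P) :=
    CompleteLattice.IsCompactElement.exists_finset_of_le_iSup _
      ((Submodule.fg_iff_compact M).1 (IsNoetherian.noetherian M)) _ le_rfl
  have hle : ∀ f ∈ I, ∀ x, f x ∈ M := fun f hf x =>
    le_iSup (fun f : I => LinearMap.range (f : Module.End S P)) ⟨f, hf⟩ ⟨x, rfl⟩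
  let φ : (s → P) →ₗ[S] M := ∑ f : s, (LinearMap.codRestrict M f.1.1 (hle f.1.1 f.1.2)) ∘ₗ
    LinearMap.proj f
  have hφ : Function.Surjective φ := by
    classical
    have hM : M ≤ (LinearMap.range φ).map M.subtype := by
      refine hs.trans (iSup₂_le fun f hf => ?_)
      rintro _ ⟨x, rfl⟩
      refine ⟨φ (Pi.single ⟨f, hf⟩ x), ⟨_, rfl⟩, ?_⟩
      simp only [φ, LinearMap.sum_apply, LinearMap.comp_apply, LinearMap.proj_apply]
      rw [Finset.sum_eq_single ⟨f, hf⟩]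
      · simp
      · intro g _ hg
        rw [Pi.single_eq_of_ne hg, map_zero]
      · simp
    intro x
    obtain ⟨y, hy, hyx⟩ := hM x.2
    rw [← LinearMap.mem_range, ← Subtype.ext hyx]
    exact hy
  have := hP M
  obtain ⟨t, ht⟩ := Module.projective_lifting_property φ LinearMap.id hφ
  -- As `M` is projective, `P ^ s → M` has a section `t`. Composing `f : P → M` with `t` writes `f`
  -- as `∑ k * b k`, which exhibits `I` as a summand of a free module.
  let i : I →ₗ[(Module.End S P)ᵐᵒᵖ] (s → Module.End S P) :=
    { toFun := fun f k => LinearMap.proj k ∘ₗ t ∘ₗ LinearMap.codRestrict M f.1 (hle f.1 f.2)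
      map_add' := fun f g => by
        ext k x
        exact congrFun (map_add t ⟨f.1 x, hle f.1 f.2 x⟩ ⟨g.1 x, hle g.1 g.2 x⟩) k
      map_smul' := fun b f => rfl }
  let p : (s → Module.End S P) →ₗ[(Module.End S P)ᵐᵒᵖ] I :=
    { toFun := fun b => ∑ k, MulOpposite.op (b k) • k.1
      map_add' := fun b c => by simp [add_smul, Finset.sum_add_distrib]
      map_smul' := fun a b => by
        rw [RingHom.id_apply, Finset.smul_sum]
        refine Finset.sum_congr rfl fun k _ => ?_
        rw [smul_smul]
        rfl }
  have : Module.Projective (Module.End S P)ᵐᵒᵖ (s → Module.End S P) :=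
    .of_equiv (LinearEquiv.piCongrRight fun _ : s => (opSelfEquiv (Module.End S P)).symm)
  refine .of_split i p (LinearMap.ext fun f => Subtype.ext (LinearMap.ext fun x => ?_))
  have h1 : (p (i f)).1 = ∑ k, k.1.1 * i f k := by
    exact map_sum I.subtype (fun k : s => MulOpposite.op (i f k) • k.1) Finset.univ
  have h2 := congrArg Subtype.val (LinearMap.congr_fun ht ⟨f.1 x, hle f.1 f.2 x⟩)
  change (p (i f)).1 x = f.1 x
  rw [h1, LinearMap.sum_apply]
  refine Eq.trans ?_ h2
  change _ = M.subtype _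
  simp only [φ, LinearMap.comp_apply, LinearMap.sum_apply, map_sum]
  rfl

section LeftSupport

variable {A : Type u} [Ring A] [IsArtinianRing Aᵐᵒᵖ]

theorem inAddLeftPart_supportingProjective :
    InAddLeftPart A (SupportingProjective (leftPart A)) := by
  have := finite_quotient_indProjSetoid (leftPart A)
  have := Fintype.ofFinite (_root_.Quotient (indProjSetoid (leftPart A)))
  exact (InAddLeftPart.pi _ fun q => inAddLeftPart_of_leftPart q.out.2.2.1).of_equiv
    (DirectSum.linearEquivFunOnFintype Aᵐᵒᵖ _ _)

theorem isHereditary_leftSupport (hA : IsAbelianExact (addClosure (leftPart A))) :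
    IsHereditary (LeftSupport A) := by
  have hP := inAddLeftPart_supportingProjective (A := A)
  have := hP.moduleFinite
  have (q : _root_.Quotient (indProjSetoid (leftPart A))) :
      Module.Projective Aᵐᵒᵖ (q.out.1 : RMod A) := q.out.2.2.2
  exact isHereditary_end fun U => hP.projective_of_injective hA U

end LeftSupport

/-! ### Indecomposable projectives when the quiver is acyclic -/

section Radical

variable {A : Type u} [Ring A]

theorem mem_jacobson_of_isNilpotent {x : A} (h : ∀ y, IsNilpotent (y * x)) :
    x ∈ Ring.jacobson A := by
  rw [← Ideal.jacobson_bot, Ideal.mem_jacobson_iff]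
  intro y
  obtain ⟨u, hu⟩ := (h y).isUnit_one_add
  refine ⟨↑u⁻¹, ?_⟩
  rw [Submodule.mem_bot, sub_eq_zero, mul_assoc, add_comm]
  calc (↑u⁻¹ : A) + ↑u⁻¹ * (y * x) = ↑u⁻¹ * (1 + y * x) := by rw [mul_add, mul_one]
    _ = 1 := by rw [← hu, Units.inv_mul]

/-- A homomorphism into `eA`, for a primitive idempotent `e`, is surjective or maps into the
radical. -/
theorem IsPrimitiveIdempotent.surjective_or_mem_jacobson [IsArtinianRing Aᵐᵒᵖ] {e : A}
    (he : IsPrimitiveIdempotent e) {Z : Type*} [AddCommGroup Z] [Module Aᵐᵒᵖ Z]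
    (g : Z →ₗ[Aᵐᵒᵖ] rightIdeal e) :
    Function.Surjective g ∨ ∀ z, (g z : A) ∈ Ring.jacobson A := by
  rw [or_iff_not_imp_right]
  intro h
  push Not at h
  obtain ⟨z, hz⟩ := h
  obtain ⟨y, hy⟩ : ∃ y, ¬ IsNilpotent (y * (g z : A)) := by
    by_contra! h
    exact hz (mem_jacobson_of_isNilpotent h)
  have hmem := @mem_rightIdeal_iff _ _ e he.1
  have hx := hmem.1 (g z).2
  let x : A := g z
  -- Left multiplication by `x * y` on `eA`. If it is nilpotent, so is `y * x`, against the choice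
  -- of `y`; if it is invertible, `e` is in `xA`, which lies in the image of `g`.
  let φ : Module.End Aᵐᵒᵖ (rightIdeal e) :=
    toRightIdeal e ∘ₗ LinearMap.mulLeft Aᵐᵒᵖ (x * y) ∘ₗ (rightIdeal e).subtype
  have hφ : ∀ w, (φ w : A) = x * y * w := fun w => by
    change e * (x * y * w) = _
    rw [← mul_assoc, ← mul_assoc, hx]
  have hee : e ∈ rightIdeal e := Submodule.mem_span_singleton_self e
  rcases he.isIndecomposableModule.isNilpotent_or_isUnit φ with ⟨n, hn⟩ | hu
  · exfalso
    have hpow : ∀ (n : ℕ) (w : rightIdeal e), (((φ ^ n) w : rightIdeal e) : A) = (x * y) ^ n * w := by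
      intro n w
      induction n with
      | zero => simp
      | succ n ih => rw [pow_succ', Module.End.mul_apply, hφ, ih, pow_succ', mul_assoc (x * y)]
    refine hy ⟨n + 1, ?_⟩
    have h0 : (x * y) ^ n * x = 0 := by
      rw [← hpow n (g z), hn]
      rfl
    change (y * x) ^ (n + 1) = 0
    rw [pow_succ', mul_assoc, ← mul_pow_mul, h0, mul_zero]
  · obtain ⟨w, hw⟩ := ((Module.End.isUnit_iff _).1 hu).2 ⟨e, hee⟩
    have hw' : x * y * w = e := by rw [← hφ, hw]
    intro t
    refine ⟨MulOpposite.op (y * w * t) • z, Subtype.ext ?_⟩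
    rw [map_smul]
    change x * (y * w * t) = t
    rw [← mul_assoc, ← mul_assoc, hw', hmem.1 t.2]

/-- The radical of `eA`, as the submodule `eA ∩ J`. -/
def radRightIdeal (e : A) : Submodule Aᵐᵒᵖ A where
  carrier := {x | e * x = x ∧ x ∈ Ring.jacobson A}
  add_mem' hx hy := ⟨by rw [mul_add, hx.1, hy.1], Submodule.add_mem _ hx.2 hy.2⟩
  zero_mem' := ⟨mul_zero e, Submodule.zero_mem _⟩
  smul_mem' a x hx := ⟨(mul_assoc e x a.unop).symm.trans (congrArg (· * a.unop) hx.1),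
    Ideal.mul_mem_right _ _ hx.2⟩

/-- A submodule of `eJ` containing each `eJfᵢ` not contained in `J²` is all of `eJ`. -/
theorem radRightIdeal_le [IsArtinianRing A] {e : A} (he : IsIdempotentElem e) {ι : Type*}
    [Fintype ι] (f : ι → A) (hsum : ∑ i, f i = 1) (N : Submodule Aᵐᵒᵖ A)
    (hN : ∀ i, (∃ a ∈ Ring.jacobson A, e * a * f i ∉ Ring.jacobson A * Ring.jacobson A) →
      ∀ x ∈ radRightIdeal e, x * f i ∈ N) : radRightIdeal e ≤ N := by
  -- A Nakayama argument: `eJ ⊆ N + J ^ k` for every `k`, and `J` is nilpotent.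
  have key : ∀ k : ℕ, ∀ x ∈ radRightIdeal e, ∃ n ∈ N, x - n ∈ Ring.jacobson A ^ k := by
    intro k
    induction k with
    | zero => exact fun x _ => ⟨0, N.zero_mem, by
      rw [Submodule.pow_zero, Ideal.one_eq_top]
      trivial⟩
    | succ k ih =>
      -- For `a, b ∈ J`, approximate `e * a` modulo `J ^ k` and multiply by `b`, which gains one
      -- power of `J`.
      have h2 : ∀ z ∈ Ring.jacobson A * Ring.jacobson A,
          ∃ n ∈ N, e * z - n ∈ Ring.jacobson A ^ (k + 1) := by
        intro z hz
        refine Submodule.smul_induction_on hz (fun a ha b hb => ?_) fun x y hx hy => ?_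
        · obtain ⟨n, hn, hn'⟩ := ih (e * a)
            ⟨by rw [← mul_assoc, he], Ideal.mul_mem_left _ _ ha⟩
          refine ⟨n * b, N.smul_mem (.op b) hn, ?_⟩
          rw [smul_eq_mul, ← mul_assoc, ← sub_mul, Submodule.pow_succ]
          exact Ideal.mul_mem_mul hn' hb
        · obtain ⟨n, hn, hn'⟩ := hx
          obtain ⟨m, hm, hm'⟩ := hy
          refine ⟨n + m, N.add_mem hn hm, ?_⟩
          rw [mul_add, add_sub_add_comm]
          exact Submodule.add_mem _ hn' hm'
      intro x hx
      have h3 : ∀ i, ∃ n ∈ N, x * f i - n ∈ Ring.jacobson A ^ (k + 1) := by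
        intro i
        by_cases hi : ∃ a ∈ Ring.jacobson A, e * a * f i ∉ Ring.jacobson A * Ring.jacobson A
        · exact ⟨x * f i, hN i hi x hx, by simp⟩
        · push Not at hi
          have := h2 _ (hi x hx.2)
          rwa [hx.1, ← mul_assoc, hx.1] at this
      choose n hn hn' using h3
      refine ⟨∑ i, n i, N.sum_mem fun i _ => hn i, ?_⟩
      have : x - ∑ i, n i = ∑ i, (x * f i - n i) := by
        rw [Finset.sum_sub_distrib, ← Finset.mul_sum, hsum, mul_one]
      rw [this]
      exact Submodule.sum_mem _ fun i _ => hn' i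
  intro x hx
  obtain ⟨k, hk⟩ := IsSemiprimaryRing.isNilpotent (R := A)
  obtain ⟨n, hn, hxn⟩ := key k x hx
  rw [hk] at hxn
  rw [sub_eq_zero.1 ((Submodule.mem_bot A).1 hxn)]
  exact hn

end Radical

/-! ### Placing the indecomposable projectives in the left part -/

section Acyclic

variable {A : Type u} [Ring A] [IsArtinianRing Aᵐᵒᵖ]

/-- `eA` as an object of `mod_A`. -/
abbrev indecomposableProjective (e : A) : RMod A := FGModuleCat.of Aᵐᵒᵖ (rightIdeal e)

/-- The last map of a path ending at `eA` is either surjective, hence an isomorphism, or lands in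
`eJ`; in the second case its source is already in the left part. -/
theorem leftPart_of_radRightIdeal {e : A} (he : IsPrimitiveIdempotent e)
    (hE : InAddLeftPart A (radRightIdeal e)) : leftPart A (indecomposableProjective e) := by
  have hind := he.isIndecomposableModule
  have hproj := projective_rightIdeal he.1
  -- The endpoint varies up to isomorphism because steps of a path may be isomorphisms.
  have key : ∀ Y Z : RMod A, IsPredecessor Y Z → Nonempty (Z ≃ₗ[Aᵐᵒᵖ] rightIdeal e) →
      HasProjectiveDimensionLE Y.obj 1 := by
    intro Y Z hYZ
    induction hYZ with
    | refl =>
      rintro ⟨a⟩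
      have : Module.Projective Aᵐᵒᵖ Y := .of_equiv a.symm
      have : Projective Y.obj := (IsProjective.iff_projective (R := Aᵐᵒᵖ) Y).1 this
      infer_instance
    | @tail Z' Z hYZ' hstep ih =>
      rintro ⟨a⟩
      obtain ⟨hZ', hZ, g, hg⟩ := hstep
      have hg' : a.toLinearMap ∘ₗ g ≠ 0 := by
        intro h
        apply hg
        ext x
        exact a.injective ((LinearMap.congr_fun h x).trans (map_zero a).symm)
      rcases he.surjective_or_mem_jacobson (a.toLinearMap ∘ₗ g) with hs | hj
      · have := hind.1
        exact ih ⟨LinearEquiv.ofBijective _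
          (((isInd_iff Z').1 hZ').bijective_of_surjective _ hs)⟩
      · let g' : Z' →ₗ[Aᵐᵒᵖ] radRightIdeal e :=
          LinearMap.codRestrict _ ((rightIdeal e).subtype ∘ₗ a.toLinearMap ∘ₗ g) fun z =>
            ⟨(mem_rightIdeal_iff he.1).1 (a (g z)).2, hj z⟩
        have hZL := hE.leftPart_of_ne_zero hZ' g' fun h => hg' <| LinearMap.ext fun z =>
          Subtype.ext (congrArg (radRightIdeal e).subtype (LinearMap.congr_fun h z) :)
        exact hZL.2 Y hYZ'
  exact ⟨(isInd_iff _).2 hind, fun Y hY => key Y _ hY ⟨LinearEquiv.refl _ _⟩⟩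

theorem leftPart_indecomposableProjective [IsArtinianRing A]
    (hA : IsAbelianExact (addClosure (leftPart A))) (hQ : QuiverAcyclic A) {e : A}
    (he : IsPrimitiveIdempotent e) : leftPart A (indecomposableProjective e) := by
  obtain ⟨ι, _, f, hf, hsum⟩ := exists_sum_isPrimitiveIdempotent (1 : A) .one
  have := finite_quiverPoint (A := A)
  -- Reversed, so that targets of arrows are smaller: the induction starts at the sinks.
  let r : QuiverPoint A → QuiverPoint A → Prop := fun x y => Relation.TransGen HasArrow y x
  have : IsTrans _ r := ⟨fun x y z hxy hyz => hyz.trans hxy⟩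
  have : Std.Irrefl r := ⟨fun x => hQ x⟩
  have hwf : WellFounded r := Finite.wellFounded_of_trans_of_irrefl r
  suffices ∀ y : QuiverPoint A, ∀ e : {e : A // IsPrimitiveIdempotent e}, ⟦e⟧ = y →
      leftPart A (indecomposableProjective e.1) from this _ ⟨e, he⟩ rfl
  intro y
  induction y using hwf.induction with
  | _ y ih =>
  rintro e rfl
  refine leftPart_of_radRightIdeal e.2 ?_
  -- For `x ∈ eJ`, left multiplication by `x` maps `fᵢA` into the trace `U`, so `x * f i ∈ U`
  -- whenever there is an arrow from `e` to `fᵢ`; these elements suffice to give `eJ ≤ U`.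
  obtain ⟨U, hU, hmem⟩ := exists_trace hA A
  have hle : radRightIdeal e.1 ≤ U := by
    refine radRightIdeal_le e.2.1 f hsum U fun i hi x hx => ?_
    have hL := ih ⟦⟨f i, hf i⟩⟧ (.single ⟨e, ⟨f i, hf i⟩, rfl, rfl, hi⟩) ⟨f i, hf i⟩ rfl
    exact hmem _ (LinearMap.mulLeft Aᵐᵒᵖ x ∘ₗ (rightIdeal (f i)).subtype)
      (inAddLeftPart_of_leftPart hL) ⟨⟨f i, Submodule.mem_span_singleton_self _⟩, rfl⟩
  exact hU.of_injective (Submodule.inclusion hle) (Submodule.inclusion_injective hle)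

theorem isHereditary_of_quiverAcyclic [IsArtinianRing A]
    (hA : IsAbelianExact (addClosure (leftPart A))) (hQ : QuiverAcyclic A) : IsHereditary A := by
  obtain ⟨ι, _, f, hf, hsum⟩ := exists_sum_isPrimitiveIdempotent (1 : A) .one
  have h : InAddLeftPart A A :=
    .of_fintype (fun i => indecomposableProjective (f i))
      (fun i => leftPart_indecomposableProjective hA hQ (hf i)) (fun i => toRightIdeal (f i))
      (fun i => (rightIdeal (f i)).subtype) (by
        refine LinearMap.ext fun x => ?_
        rw [LinearMap.sum_apply]
        change ∑ i, f i * x = x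
        rw [← Finset.sum_mul, hsum, one_mul])
  exact fun I => h.projective_of_injective hA I

/-- A basic algebra whose indecomposable projectives all lie in the left part is isomorphic to its
supporting projective. -/
theorem nonempty_equiv_supportingProjective (hb : IsBasic A)
    (hL : ∀ e : A, IsPrimitiveIdempotent e → leftPart A (indecomposableProjective e)) :
    Nonempty (A ≃ₗ[Aᵐᵒᵖ] SupportingProjective (leftPart A)) := by
  classical
  obtain ⟨n, e, hco, he, hne⟩ := hb
  have h : ∀ q : _root_.Quotient (indProjSetoid (leftPart A)),
      ∃ i, Nonempty (q.out.1 ≃ₗ[Aᵐᵒᵖ] rightIdeal (e i)) := fun q =>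
    have := q.out.2.2.2
    exists_equiv_rightIdeal e he hco.complete ((isInd_iff _).1 q.out.2.1)
  choose σ hσ using h
  -- Surjectivity is where basicness is used: the class of `e i` goes to some index with an
  -- isomorphic ideal, which must be `i`.
  have hσb : Function.Bijective σ := by
    refine ⟨fun q r hqr => ?_, fun i => ?_⟩
    · obtain ⟨a⟩ := hσ q
      obtain ⟨b⟩ := hσ r
      rw [← hqr] at b
      rw [← Quotient.out_eq q, ← Quotient.out_eq r]
      exact Quotient.sound ⟨a.trans b.symm⟩
    · have hLi := hL (e i) (he i)
      let X : IndProj (leftPart A) :=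
        ⟨indecomposableProjective (e i), hLi.1, hLi, projective_rightIdeal (he i).1⟩
      refine ⟨⟦X⟧, ?_⟩
      obtain ⟨a⟩ := hσ ⟦X⟧
      obtain ⟨b⟩ := Quotient.mk_out (s := indProjSetoid (leftPart A)) X
      by_contra h
      exact (hne _ _ h).false (a.symm.trans b)
  let s := Equiv.ofBijective σ hσb
  have := Fintype.ofEquiv _ s.symm
  let toPi : A ≃ₗ[Aᵐᵒᵖ] (∀ i, rightIdeal (e i)) :=
    { LinearMap.pi fun i => toRightIdeal (e i) with
      invFun := fun x => ∑ i, (x i : A)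
      left_inv := fun x => by
        change ∑ i, e i * x = x
        rw [← Finset.sum_mul, hco.complete, one_mul]
      right_inv := fun x => by
        ext i
        change e i * ∑ j, (x j : A) = x i
        have hx := fun j => (mem_rightIdeal_iff (he j).1).1 (x j).2
        rw [Finset.mul_sum, Finset.sum_eq_single i, hx]
        · intro j _ hj
          rw [← hx j, ← mul_assoc, hco.ortho hj.symm, zero_mul]
        · simp }
  exact ⟨toPi ≪≫ₗ LinearEquiv.piCongrLeft' Aᵐᵒᵖ (fun i => rightIdeal (e i)) s.symm ≪≫ₗ
    LinearEquiv.piCongrRight (fun q => (hσ q).some.symm) ≪≫ₗ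
    (DirectSum.linearEquivFunOnFintype Aᵐᵒᵖ _ _).symm⟩

end Acyclic

/-- A right module isomorphic to `A` has endomorphism ring `A`. -/
def ringEquivEnd {A : Type u} [Ring A] {P : Type*} [AddCommGroup P] [Module Aᵐᵒᵖ P]
    (t : A ≃ₗ[Aᵐᵒᵖ] P) : A ≃+* Module.End Aᵐᵒᵖ P where
  toFun a := t.toLinearMap ∘ₗ LinearMap.mulLeft Aᵐᵒᵖ a ∘ₗ t.symm.toLinearMap
  invFun g := t.symm (g (t 1))
  left_inv a := by simp
  right_inv g := by
    refine LinearMap.ext fun x => ?_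
    obtain ⟨y, rfl⟩ := t.surjective x
    have h1 : t y = MulOpposite.op y • t 1 := by
      rw [← map_smul]
      exact congrArg t (one_mul y).symm
    have h2 : t.symm (g (t 1)) * y = t.symm (MulOpposite.op y • g (t 1)) := (map_smul t.symm _ _).symm
    simp only [LinearMap.comp_apply, LinearEquiv.coe_coe, LinearEquiv.symm_apply_apply,
      LinearMap.mulLeft_apply]
    rw [h2, LinearEquiv.apply_symm_apply, h1, map_smul]
  map_mul' a b := by
    ext x
    simp
  map_add' a b := by
    ext x
    simp [add_mul]

/-- An isomorphism of right modules from `A` to the supporting projective identifies `A` with the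
left support. -/
noncomputable def algEquivLeftSupport (R : Type v) [CommRing R] {A : Type u} [Ring A] [Algebra R A]
    (t : A ≃ₗ[Aᵐᵒᵖ] SupportingProjective (leftPart A)) : A ≃ₐ[R] LeftSupport A :=
  AlgEquiv.ofRingEquiv (f := (ringEquivEnd t : A ≃+* LeftSupport A)) fun r => by
    refine LinearMap.ext fun x => ?_
    have h1 : algebraMap R A r * t.symm x = t.symm (MulOpposite.op (algebraMap R A r) • x) := by
      rw [map_smul]
      exact Algebra.commutes r (t.symm x)
    change t (algebraMap R A r * t.symm x) = MulOpposite.op (algebraMap R A r) • x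
    rw [h1, LinearEquiv.apply_symm_apply]

end ArtinLeft

theorem mainTheorem5 {R : Type v} [CommRing R] [IsArtinianRing R]
    {A : Type u} [Ring A] [Algebra R A] [Module.Finite R A]
    (hA : ArtinLeft.IsAbelianExact (ArtinLeft.addClosure (ArtinLeft.leftPart A))) :
    ArtinLeft.IsHereditary (ArtinLeft.LeftSupport A) ∧
    ArtinLeft.IsLeftSupported A ∧
    (ArtinLeft.QuiverAcyclic A →
      (ArtinLeft.IsBasic A → Nonempty (A ≃ₐ[R] ArtinLeft.LeftSupport A)) ∧
      ArtinLeft.IsHereditary A) := by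
  -- Both sides are needed: right artinian for finite length in `mod_A`, left artinian for the
  -- nilpotency of `J`.
  have := IsArtinianRing.of_finite R A
  have : Module.Finite R Aᵐᵒᵖ := .equiv (MulOpposite.opLinearEquiv R)
  have := IsArtinianRing.of_finite R Aᵐᵒᵖ
  refine ⟨ArtinLeft.isHereditary_leftSupport hA, ArtinLeft.isLeftSupported_of_isAbelianExact hA,
    fun hQ => ⟨fun hb => ?_, ArtinLeft.isHereditary_of_quiverAcyclic hA hQ⟩⟩
  obtain ⟨t⟩ := ArtinLeft.nonempty_equiv_supportingProjective hb fun e he =>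
    ArtinLeft.leftPart_indecomposableProjective hA hQ he
  exact ⟨ArtinLeft.algEquivLeftSupport R t⟩
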